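/- Let $K$ be a compact, linearly ordered space, that is, a linearly ordered set whose order topology is compact. Say that a metric $d : K\times K\to[0,\infty)$ (not assumed to be related to the topology of $K$) fragments $K$ if for every non-empty set $M\subseteq K$ and every $\varepsilon>0$ there is an open set $U\subseteq K$ such that $M\cap U\neq\varnothing$ and the $d$-diameter of $M\cap U$ is less than $\varepsilon$. A subset of $K$ is called scattered if each of its non-empty subsets has a relatively isolated point. Then the following are equivalent. (1) $K$ is fragmentable, i.e. some metric on $K$ fragments $K$. (2) There is a family $L_n$, $n\in\mathbb{N}$, of compact, scattered subsets of $K$, with union $L=\bigcup_{n} L_n$, such that whenever $u,v\in K$ and $u<v$, there exist $x,y\in L$ satisfying $u\le x<y\le v$. (3) $K$ is Radon–Nikodým compact, i.e. some metric on $K$ that is lower semicontinuous as a function on $K\times K$ (with the product topology) fragments $K$. -/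

import Mathlib

open scoped ENNReal

namespace FragOrder

/-- `d` is a metric on the set `K` (not assumed to have anything to do with a topology on `K`). -/
structure IsMetric {K : Type*} (d : K → K → ℝ) : Prop where
  nonneg : ∀ x y, 0 ≤ d x y
  eq_zero_iff : ∀ x y, d x y = 0 ↔ x = y
  symm : ∀ x y, d x y = d y x
  triangle : ∀ x y z, d x z ≤ d x y + d y z

/-- The `d`-diameter of `A`, with value `∞` if `d` is unbounded on `A`. -/
noncomputable def diam {K : Type*} (d : K → K → ℝ) (A : Set K) : ℝ≥0∞ :=
  ⨆ (x ∈ A) (y ∈ A), ENNReal.ofReal (d x y)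

/-- `d` fragments the topological space `K`: every non-empty subset of `K` has non-empty
relatively open subsets of arbitrarily small `d`-diameter. -/
def Fragments {K : Type*} [TopologicalSpace K] (d : K → K → ℝ) : Prop :=
  ∀ M : Set K, M.Nonempty → ∀ ε : ℝ, 0 < ε →
    ∃ U : Set K, IsOpen U ∧ (M ∩ U).Nonempty ∧ diam d (M ∩ U) < ENNReal.ofReal ε

/-- `K` is fragmentable: some metric on `K` fragments it. -/
def IsFragmentable (K : Type*) [TopologicalSpace K] : Prop :=
  ∃ d : K → K → ℝ, IsMetric d ∧ Fragments d

/-- The Radon–Nikodým property of a compact space `K`: some metric that is lower semicontinuous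
on `K × K` fragments it. -/
def IsRadonNikodym (K : Type*) [TopologicalSpace K] : Prop :=
  ∃ d : K → K → ℝ, IsMetric d ∧ Fragments d ∧
    LowerSemicontinuous (fun p : K × K => d p.1 p.2)

/-- The subset `S` is scattered: every non-empty subset of `S` has a (relatively) isolated
point. -/
def IsScattered {K : Type*} [TopologicalSpace K] (S : Set K) : Prop :=
  ∀ A : Set K, A ⊆ S → A.Nonempty → ∃ x ∈ A, ∃ U : Set K, IsOpen U ∧ A ∩ U = {x}

end FragOrder

/-!
The implication from the Radon–Nikodým property to fragmentability is trivial.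

*Scattered sets yield a lower semicontinuous metric.* Two neighbouring points `a < b` of a compact
scattered set `L` are the end points of a gap of `L`, and by `IsScattered.exists_isGap_between`
there is a gap between any two points of `L`. Urysohn's lemma gives for each gap a continuous
function that is `0` to the left of the gap and `1` to its right. Outside `L` at most one of these
functions varies locally, and nonempty subsets of `L` have isolated points, so the supremum over
all gaps of the differences is a pseudometric that fragments `K`
(`IsScattered.exists_isOpen_gap_oscillation`); it is lower semicontinuous as a supremum of
continuous functions. A weighted supremum over the pairwise unions of the
given sets is the metric wanted.

*Fragmentability yields scattered sets.* Exhausting `K` transfinitely by relatively open pieces of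
diameter less than `1 / (m + 1)` gives an upper semicontinuous function `r m` from `K` to the
ordinals whose level sets have small diameter (`Fragments.exists_rank`); the functions `r m`
together separate points. Starting from the two end points of `K`, an increasing sequence of compact
scattered sets `L n` is built as follows: to `L n` are added, in each of its gaps `(a, b)`, the
least and the greatest point of `[a, b]` where `r m` is maximal, for all `m ≤ n`, and the closures
of a well-ordered set cofinal in `[a, b)` and of a reversely well-ordered set coinitial in `(a, b]`
(`exists_refinement_sequence`). By the latter, `[c, p)` and `(p, c]`, if nonempty, meet
the union `L` whenever `p` is in `L`, so that it remains to find a point of `L` in `[u, v]` for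
`u < v`. If there were none, then `u` and `v` would lie in gaps `(a n, b n)` of `L n` that shrink strictly on both sides. The
maximum of `r m` over `[a n, b n]` decreases with `n`, so it is eventually a constant ordinal `ρ`.
If the least point `x` of the intersection of these intervals had `r m x < ρ`, then `r m` would be
below `ρ` near `x`, and the first maximum point, lying in the next set of the sequence but to the
right of `x`, would be cut off in the next step, which lowers the maximum
(`eq_of_isLeast_iInter`). So `r m` is `ρ` at the least and likewise at the greatest
point of the intersection, for every `m`, and these two points coincide, contrary to `u < v`.
-/

namespace FragOrder

open Set Filter Topology

/-! ### Scattered sets -/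

section Scattered

variable {X : Type*} [TopologicalSpace X]

/-- If one of two scattered sets is closed, then their union is scattered. -/
lemma IsScattered.union {S T : Set X} (hS : IsScattered S) (hT : IsScattered T)
    (hTc : IsClosed T) : IsScattered (S ∪ T) := by
  intro A hA hne
  by_cases hAT : A ⊆ T
  · exact hT A hAT hne
  · obtain ⟨x, hxA, hxT⟩ := not_subset.1 hAT
    obtain ⟨y, hy, U, hU, hAU⟩ := hS (A ∩ Tᶜ)
      (fun z hz => (hA hz.1).resolve_right hz.2) ⟨x, hxA, hxT⟩
    exact ⟨y, hy.1, Tᶜ ∩ U, hTc.isOpen_compl.inter hU, by rw [← inter_assoc]; exact hAU⟩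

lemma _root_.Set.Finite.isScattered [T1Space X] {S : Set X} (hS : S.Finite) : IsScattered S := by
  rintro A hA ⟨x, hx⟩
  refine ⟨x, hx, (A \ {x})ᶜ, ((hS.subset hA).subset sdiff_subset).isClosed.isOpen_compl, ?_⟩
  ext y
  by_cases hy : y = x
  · simp [hy, hx]
  · simp [hy]

end Scattered

section WellOrdered

variable {K : Type*} [LinearOrder K]

/-- Every interval `[a, b)` has a well-ordered cofinal subset: with respect to some
well-ordering `≺` of `K`, the points that are larger than all their `≺`-predecessors. -/
lemma exists_isWF_cofinal (a b : K) :
    ∃ S ⊆ Ico a b, S.IsWF ∧ ∀ c ∈ Ico a b, ∃ s ∈ S, c ≤ s := by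
  refine ⟨{x | x ∈ Ico a b ∧ ∀ y ∈ Ico a b, WellOrderingRel y x → y < x},
    fun x hx => hx.1, ?_, ?_⟩
  · refine Subrelation.wf (r := InvImage WellOrderingRel Subtype.val) ?_
      (InvImage.wf _ WellOrderingRel.isWellOrder.wf)
    rintro ⟨x, hx⟩ ⟨y, hy⟩ (hxy : x < y)
    rcases trichotomous_of WellOrderingRel x y with h | h | h
    · exact h
    · exact absurd h hxy.ne
    · exact absurd (hx.2 y hy.1 h) hxy.asymm
  · intro c hc
    have hwf : WellFounded (WellOrderingRel (α := K)) := WellOrderingRel.isWellOrder.wf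
    have hne : (Ico c b).Nonempty := ⟨c, le_rfl, hc.2⟩
    have hm := hwf.min_mem (Ico c b) hne
    refine ⟨hwf.min (Ico c b) hne, ⟨⟨hc.1.trans hm.1, hm.2⟩, fun y hy hyr => ?_⟩, hm.1⟩
    by_contra! hle
    exact hwf.not_lt_min (Ico c b) ⟨hm.1.trans hle, hy.2⟩ hyr

variable [TopologicalSpace K] [OrderTopology K]

/-- In a well-ordered set `A`, the least element is isolated by the ray below its successor. -/
lemma _root_.Set.IsWF.isScattered {S : Set K} (hS : S.IsWF) : IsScattered S := by
  intro A hA hne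
  have hA' : A.IsWF := hS.mono hA
  have hmin : ∀ z ∈ A, hA'.min hne ≤ z := fun z hz => hA'.min_le hne hz
  refine ⟨hA'.min hne, hA'.min_mem hne, ?_⟩
  by_cases hB : (A ∩ Ioi (hA'.min hne)).Nonempty
  · have hB' : (A ∩ Ioi (hA'.min hne)).IsWF := hA'.mono inter_subset_left
    refine ⟨Iio (hB'.min hB), isOpen_Iio, ?_⟩
    refine Subset.antisymm (fun z hz => ?_) ?_
    · by_contra hne'
      exact absurd hz.2 (not_lt.2 (hB'.min_le hB
        ⟨hz.1, lt_of_le_of_ne (hmin z hz.1) (Ne.symm hne')⟩))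
    · rintro _ rfl
      exact ⟨hA'.min_mem hne, (hB'.min_mem hB).2⟩
  · refine ⟨univ, isOpen_univ, ?_⟩
    refine Subset.antisymm (fun z hz => ?_) ?_
    · by_contra hne'
      exact hB ⟨z, hz.1, lt_of_le_of_ne (hmin z hz.1) (Ne.symm hne')⟩
    · rintro _ rfl
      exact ⟨hA'.min_mem hne, trivial⟩

lemma _root_.Set.IsWF.closure {W : Set K} (hW : W.IsWF) : (closure W).IsWF := by
  refine WellFounded.wellFounded_iff_has_min.2 fun A hne => ?_
  by_contra! hmin
  -- Below every point of `A` there are two more, and a point of `W` between them, so the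
  -- points of `W` lying above some point of `A` have no least element.
  have key : ∀ x ∈ A, ∃ w ∈ W, w < x.1 ∧ ∃ z ∈ A, z.1 < w := by
    intro x hx
    obtain ⟨y, hy, hyx⟩ := hmin x hx
    obtain ⟨z, hz, hzy⟩ := hmin y hy
    obtain ⟨w, hw, hwW⟩ := mem_closure_iff.1 y.2 (Ioo z.1 x.1) isOpen_Ioo ⟨hzy, hyx⟩
    exact ⟨w, hwW, hw.2, z, hz, hw.1⟩
  obtain ⟨x, hx⟩ := hne
  obtain ⟨w, hw, -, hz⟩ := key x hx
  have hB : {w | w ∈ W ∧ ∃ z ∈ A, z.1 < w}.IsWF := hW.mono fun _ h => h.1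
  have hBne : {w | w ∈ W ∧ ∃ z ∈ A, z.1 < w}.Nonempty := ⟨w, hw, hz⟩
  obtain ⟨z, hzA, hzlt⟩ := (hB.min_mem hBne).2
  obtain ⟨w', hw', hlt, hz'⟩ := key z hzA
  exact hB.not_lt_min hBne ⟨hw', hz'⟩ (hlt.trans hzlt)

variable [CompactSpace K]

/-- A compact scattered subset of `[a, b]` that either accumulates at `b` from the left or
contains the immediate predecessor of `b`. -/
lemma exists_isCompact_isScattered_cofinal (a b : K) :
    ∃ S ⊆ Icc a b, IsCompact S ∧ IsScattered S ∧ ∀ c, a ≤ c → c < b → ∃ s ∈ S, c ≤ s ∧ s < b := by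
  obtain ⟨S, hS, hwf, hcof⟩ := exists_isWF_cofinal a b
  refine ⟨closure S, closure_minimal (hS.trans Ico_subset_Icc_self) isClosed_Icc,
    isClosed_closure.isCompact, hwf.closure.isScattered, fun c hac hcb => ?_⟩
  obtain ⟨s, hs, hcs⟩ := hcof c ⟨hac, hcb⟩
  exact ⟨s, subset_closure hs, hcs, (hS hs).2⟩

lemma exists_isCompact_isScattered_coinitial (a b : K) :
    ∃ S ⊆ Icc a b, IsCompact S ∧ IsScattered S ∧ ∀ c, a < c → c ≤ b → ∃ s ∈ S, a < s ∧ s ≤ c := by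
  have : CompactSpace Kᵒᵈ := ‹CompactSpace K›
  obtain ⟨S, hS, hc, hs, hcof⟩ :=
    exists_isCompact_isScattered_cofinal (OrderDual.toDual b) (OrderDual.toDual a)
  refine ⟨S, fun x hx => ⟨(hS hx).2, (hS hx).1⟩, hc, hs, fun c hac hcb => ?_⟩
  obtain ⟨s, hsS, h1, h2⟩ := hcof (OrderDual.toDual c) hcb hac
  exact ⟨s, hsS, h2, h1⟩

end WellOrdered

/-! ### Gaps of compact sets -/

section Gap

variable {K : Type*} [LinearOrder K]

/-- `(a, b)` is a gap of `L`: its end points `a < b` are neighbours in the order induced on `L`. -/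
def IsGap (L : Set K) (a b : K) : Prop :=
  a ∈ L ∧ b ∈ L ∧ a < b ∧ ∀ x ∈ L, x ≤ a ∨ b ≤ x

lemma IsGap.eq_of_mem_Ioo {L : Set K} {a b a' b' x : K} (h : IsGap L a b) (h' : IsGap L a' b')
    (hx : x ∈ Ioo a b) (hx' : x ∈ Ioo a' b') : a = a' ∧ b = b' := by
  constructor
  · exact le_antisymm
      ((h'.2.2.2 a h.1).resolve_right fun hle => (hx'.2.trans_le hle).asymm hx.1)
      ((h.2.2.2 a' h'.1).resolve_right fun hle => (hx.2.trans_le hle).asymm hx'.1)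
  · exact le_antisymm
      ((h.2.2.2 b' h'.2.1).resolve_left fun hle => (hx'.2.trans_le hle).asymm hx.1)
      ((h'.2.2.2 b h.2.1).resolve_left fun hle => (hx.2.trans_le hle).asymm hx'.1)

lemma IsGap.notMem_Ioo {L : Set K} {a b x : K} (h : IsGap L a b) (hx : x ∈ L) : x ∉ Ioo a b :=
  fun hx' => (h.2.2.2 x hx).elim (fun hle => hle.not_gt hx'.1) fun hle => hle.not_gt hx'.2

variable [TopologicalSpace K] [OrderTopology K]

/-- If the compact set `L` has points on both sides of `[u, v]`, but none in the interior, and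
`[u, v]` is not a single point of `L`, then `[u, v]` lies in the closure of a gap of `L`. -/
lemma exists_isGap {L : Set K} (hL : IsCompact L) {u v : K} (huv : u ≤ v)
    (hu : ∃ l ∈ L, l ≤ u) (hv : ∃ l ∈ L, v ≤ l) (hsep : ∀ x ∈ L, x ≤ u ∨ v ≤ x)
    (hne : u < v ∨ u ∉ L) : ∃ a b, IsGap L a b ∧ a ≤ u ∧ v ≤ b := by
  obtain ⟨l, hl, hlu⟩ := hu
  obtain ⟨l', hl', hvl'⟩ := hv
  obtain ⟨a, ha, ha'⟩ := (hL.inter_right (isClosed_Iic (a := u))).exists_isGreatest ⟨l, hl, hlu⟩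
  obtain ⟨b, hb, hb'⟩ := (hL.inter_right (isClosed_Ici (a := v))).exists_isLeast ⟨l', hl', hvl'⟩
  refine ⟨a, b, ⟨ha.1, hb.1, ?_, fun x hx => ?_⟩, ha.2, hb.2⟩
  · rcases hne with h | h
    · exact lt_of_le_of_lt ha.2 (h.trans_le hb.2)
    · exact lt_of_lt_of_le (lt_of_le_of_ne ha.2 fun h' => h (h' ▸ ha.1)) (huv.trans hb.2)
  · exact (hsep x hx).imp (fun h => ha' ⟨hx, h⟩) fun h => hb' ⟨hx, h⟩

/-- Between any two points of a compact scattered set there is a gap: an isolated point of the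
part between them is an end point of one. -/
lemma IsScattered.exists_isGap_between {L : Set K} (hs : IsScattered L) (hL : IsCompact L)
    {x y : K} (hx : x ∈ L) (hy : y ∈ L) (hxy : x < y) :
    ∃ a b, IsGap L a b ∧ x ≤ a ∧ b ≤ y := by
  obtain ⟨p, hp, U, hU, hpU⟩ := hs (L ∩ Icc x y) inter_subset_left ⟨x, hx, le_rfl, hxy.le⟩
  have hpU' : p ∈ U := (hpU.symm.subset rfl).2
  have hA : IsCompact ((L ∩ Icc x y) ∩ Uᶜ) :=
    (hL.inter_right isClosed_Icc).inter_right hU.isClosed_compl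
  have hmem : ∀ q ∈ L ∩ Icc x y, q ≠ p → q ∈ (L ∩ Icc x y) ∩ Uᶜ :=
    fun q hq hqp => ⟨hq, fun hqU => hqp (hpU.subset ⟨hq, hqU⟩)⟩
  rcases hp.2.2.lt_or_eq with hpy | rfl
  · obtain ⟨b, hb, hb'⟩ := (hA.inter_right (isClosed_Ici (a := p))).exists_isLeast
      ⟨y, hmem y ⟨hy, hxy.le, le_rfl⟩ hpy.ne', hpy.le⟩
    have hpb : p < b := lt_of_le_of_ne hb.2 fun h => hb.1.2 (h ▸ hpU')
    refine ⟨p, b, ⟨hp.1, hb.1.1.1, hpb, fun z hz => ?_⟩, hp.2.1, hb.1.1.2.2⟩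
    by_contra! hzlt
    exact hzlt.2.not_ge (hb' ⟨hmem z ⟨hz, hp.2.1.trans hzlt.1.le,
      hzlt.2.le.trans hb.1.1.2.2⟩ hzlt.1.ne', hzlt.1.le⟩)
  · obtain ⟨a, ha, ha'⟩ := (hA.inter_right (isClosed_Iic (a := p))).exists_isGreatest
      ⟨x, hmem x ⟨hx, le_rfl, hxy.le⟩ hxy.ne, hxy.le⟩
    have hap : a < p := lt_of_le_of_ne ha.2 fun h => ha.1.2 (h ▸ hpU')
    refine ⟨a, p, ⟨ha.1.1.1, hp.1, hap, fun z hz => ?_⟩, ha.1.1.2.1, le_rfl⟩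
    by_contra! hzlt
    exact hzlt.1.not_ge (ha' ⟨hmem z ⟨hz, ha.1.1.2.1.trans hzlt.1.le, hzlt.2.le⟩ hzlt.2.ne,
      hzlt.2.le⟩)

end Gap

/-! ### Upper semicontinuous ordinal functions from a fragmenting metric -/

section Rank

universe u

variable {X : Type u}

/-- The transfinite exhaustion of `X` by the sets that the operation `Φ` produces from what has
been exhausted before: the set reached before stage `ξ`. -/
noncomputable def exhaustion (Φ : Set X → Set X) (ξ : Ordinal.{u}) : Set X :=
  ⋃ η : Iio ξ, Φ (exhaustion Φ η)
termination_by ξ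
decreasing_by exact η.2

lemma mem_exhaustion {Φ : Set X → Set X} {ξ : Ordinal.{u}} {x : X} :
    x ∈ exhaustion Φ ξ ↔ ∃ η < ξ, x ∈ Φ (exhaustion Φ η) := by
  rw [exhaustion]
  simp

variable [TopologicalSpace X]

/-- A metric fragmenting `X` yields, for every `ε > 0`, a partition of `X` into sets of diameter
less than `ε`, indexed by ordinals in such a way that the initial unions are open. -/
lemma Fragments.exists_rank {d : X → X → ℝ} (hd : Fragments d) {ε : ℝ} (hε : 0 < ε) :
    ∃ r : X → Ordinal.{u}, UpperSemicontinuous r ∧ ∀ x y, r x = r y → d x y < ε := by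
  have hex : ∀ V : Set X, ∃ W : Set X, IsOpen W ∧ (V ≠ univ → (Vᶜ ∩ W).Nonempty) ∧
      ∀ x ∈ Vᶜ ∩ W, ∀ y ∈ Vᶜ ∩ W, d x y < ε := by
    intro V
    by_cases hV : V = univ
    · exact ⟨∅, isOpen_empty, fun h => absurd hV h, by simp⟩
    · obtain ⟨W, hW, hne, hdiam⟩ := hd Vᶜ (nonempty_compl.2 hV) ε hε
      refine ⟨W, hW, fun _ => hne, fun x hx y hy => ?_⟩
      have : ENNReal.ofReal (d x y) < ENNReal.ofReal ε :=
        lt_of_le_of_lt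
        (le_iSup₂_of_le (f := fun a _ => ⨆ b ∈ Vᶜ ∩ W, ENNReal.ofReal (d a b)) x hx
          (le_iSup₂_of_le (f := fun b _ => ENNReal.ofReal (d x b)) y hy le_rfl)) hdiam
      exact (ENNReal.ofReal_lt_ofReal_iff hε).1 this
  choose Φ hopen hne hdiam using hex
  have hcover : ∀ x, ∃ ξ, x ∈ Φ (exhaustion Φ ξ) := by
    by_contra! hx
    obtain ⟨x, hx⟩ := hx
    have hproper : ∀ ξ, exhaustion Φ ξ ≠ univ := by
      intro ξ h
      obtain ⟨η, -, hη⟩ := mem_exhaustion.1 (h.symm.subset (mem_univ x))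
      exact hx η hη
    -- Otherwise every stage would contribute a new point, so that `X` had too many points.
    choose y hy using fun ξ => hne _ (hproper ξ)
    refine not_injective_of_ordinal y fun ξ η h => ?_
    rcases lt_trichotomy ξ η with hlt | heq | hlt
    · exact absurd (mem_exhaustion.2 ⟨ξ, hlt, h ▸ (hy ξ).2⟩) (hy η).1
    · exact heq
    · exact absurd (mem_exhaustion.2 ⟨η, hlt, h ▸ (hy η).2⟩) (hy ξ).1
  let r : X → Ordinal.{u} := fun x => sInf {ξ | x ∈ Φ (exhaustion Φ ξ)}
  have hr : ∀ x, x ∈ Φ (exhaustion Φ (r x)) := fun x =>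
    csInf_mem (s := {ξ | x ∈ Φ (exhaustion Φ ξ)}) (hcover x)
  have hlt : ∀ x ξ, r x < ξ ↔ x ∈ exhaustion Φ ξ := fun x ξ =>
    ⟨fun h => mem_exhaustion.2 ⟨r x, h, hr x⟩, fun h => by
      obtain ⟨η, hη, hx⟩ := mem_exhaustion.1 h
      exact (csInf_le' (s := {ξ | x ∈ Φ (exhaustion Φ ξ)}) hx).trans_lt hη⟩
  refine ⟨r, ?_, fun x y hxy => ?_⟩
  · rw [upperSemicontinuous_iff_isOpen_preimage]
    intro ξ
    have : r ⁻¹' Iio ξ = ⋃ η : Iio ξ, Φ (exhaustion Φ η) := by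
      rw [← exhaustion]
      ext x
      exact hlt x ξ
    rw [this]
    exact isOpen_iUnion fun η => hopen _
  · refine hdiam (exhaustion Φ (r x)) x ⟨fun h => ?_, hr x⟩ y ⟨fun h => ?_, hxy ▸ hr y⟩
    · exact lt_irrefl _ ((hlt x _).2 h)
    · exact lt_irrefl _ (hxy ▸ (hlt y _).2 h)

end Rank

/-! ### Refining a scattered set inside its gaps -/

section Refinement

variable {K : Type*} [LinearOrder K] [TopologicalSpace K] [OrderTopology K] [CompactSpace K]

/-- Compact scattered sets chosen inside the gaps of a compact scattered set `L` can be added to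
`L` simultaneously: a limit of points from different gaps lies in `L`. -/
lemma isCompact_isScattered_union_gaps {L : Set K} (hL : IsCompact L) (hs : IsScattered L)
    (hbot : ∀ x, ∃ l ∈ L, l ≤ x) (htop : ∀ x, ∃ l ∈ L, x ≤ l) {S : K → K → Set K}
    (hS : ∀ a b, IsGap L a b → S a b ⊆ Icc a b ∧ IsCompact (S a b) ∧ IsScattered (S a b)) :
    IsCompact (L ∪ {x | ∃ a b, IsGap L a b ∧ x ∈ S a b}) ∧
      IsScattered (L ∪ {x | ∃ a b, IsGap L a b ∧ x ∈ S a b}) := by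
  set T : Set K := L ∪ {x | ∃ a b, IsGap L a b ∧ x ∈ S a b} with hT
  have hgap : ∀ x ∉ L, ∃ a b, IsGap L a b ∧ x ∈ Ioo a b := by
    intro x hx
    obtain ⟨a, b, hab, hax, hxb⟩ := exists_isGap hL (le_refl x) (hbot x) (htop x)
      (fun z _ => le_total z x) (Or.inr hx)
    exact ⟨a, b, hab, lt_of_le_of_ne hax fun h => hx (h ▸ hab.1),
      lt_of_le_of_ne hxb fun h => hx (h ▸ hab.2.1)⟩
  have hlocal : ∀ a b, IsGap L a b → T ∩ Ioo a b ⊆ S a b := by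
    rintro a b hab x ⟨hxT, hx⟩
    have hxL : x ∉ L := fun h => hab.notMem_Ioo h hx
    obtain ⟨a', b', hab', hxS⟩ := hxT.resolve_left hxL
    have hx' := (hS a' b' hab').1 hxS
    have hx'' : x ∈ Ioo a' b' := ⟨lt_of_le_of_ne hx'.1 fun h => hxL (h ▸ hab'.1),
      lt_of_le_of_ne hx'.2 fun h => hxL (h ▸ hab'.2.1)⟩
    obtain ⟨rfl, rfl⟩ := hab.eq_of_mem_Ioo hab' hx hx''
    exact hxS
  constructor
  · refine IsClosed.isCompact (isOpen_compl_iff.1 (isOpen_iff_mem_nhds.2 fun x hx => ?_))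
    obtain ⟨a, b, hab, hxab⟩ := hgap x fun h => hx (Or.inl h)
    have hxS : x ∉ S a b := fun h => hx (Or.inr ⟨a, b, hab, h⟩)
    filter_upwards [isOpen_Ioo.mem_nhds hxab,
      (hS a b hab).2.1.isClosed.isOpen_compl.mem_nhds hxS] with y hy hyS hyT
    exact hyS (hlocal a b hab ⟨hyT, hy⟩)
  · intro A hA hne
    by_cases hAL : A ⊆ L
    · exact hs A hAL hne
    · obtain ⟨x, hxA, hxL⟩ := not_subset.1 hAL
      obtain ⟨a, b, hab, hx⟩ := hgap x hxL
      obtain ⟨y, hy, U, hU, hAU⟩ := (hS a b hab).2.2 (A ∩ Ioo a b)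
        (fun z hz => hlocal a b hab ⟨hA hz.1, hz.2⟩) ⟨x, hxA, hx⟩
      exact ⟨y, hy.1, Ioo a b ∩ U, isOpen_Ioo.inter hU, by rw [← inter_assoc]; exact hAU⟩

/-- A compact scattered set can be refined so as to contain finitely many prescribed points of each
gap and to be cofinal and coinitial in the interior of each gap. -/
lemma exists_refinement {L : Set K} (hL : IsCompact L) (hs : IsScattered L)
    (hbot : ∀ x, ∃ l ∈ L, l ≤ x) (htop : ∀ x, ∃ l ∈ L, x ≤ l) (F : K → K → Set K)
    (hF : ∀ a b, a < b → (F a b).Finite ∧ F a b ⊆ Icc a b) :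
    ∃ L' : Set K, L ⊆ L' ∧ IsCompact L' ∧ IsScattered L' ∧ ∀ a b, IsGap L a b → F a b ⊆ L' ∧
      (∀ c, a ≤ c → c < b → ∃ s ∈ L', c ≤ s ∧ s < b) ∧
      (∀ c, a < c → c ≤ b → ∃ s ∈ L', a < s ∧ s ≤ c) := by
  choose R hR hRc hRs hRcof using exists_isCompact_isScattered_cofinal (K := K)
  choose Q hQ hQc hQs hQcoi using exists_isCompact_isScattered_coinitial (K := K)
  obtain ⟨hc, hs'⟩ := isCompact_isScattered_union_gaps hL hs hbot htop
    (S := fun a b => F a b ∪ R a b ∪ Q a b) fun a b hab =>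
      ⟨union_subset (union_subset (hF a b hab.2.2.1).2 (hR a b)) (hQ a b),
        ((hF a b hab.2.2.1).1.isCompact.union (hRc a b)).union (hQc a b),
        ((hF a b hab.2.2.1).1.isScattered.union (hRs a b) (hRc a b).isClosed).union
          (hQs a b) (hQc a b).isClosed⟩
  refine ⟨_, subset_union_left, hc, hs', fun a b hab => ⟨fun x hx => ?_, fun c hac hcb => ?_,
    fun c hac hcb => ?_⟩⟩
  · exact Or.inr ⟨a, b, hab, Or.inl (Or.inl hx)⟩
  · obtain ⟨s, hs, h⟩ := hRcof a b c hac hcb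
    exact ⟨s, Or.inr ⟨a, b, hab, Or.inl (Or.inr hs)⟩, h⟩
  · obtain ⟨s, hs, h⟩ := hQcoi a b c hac hcb
    exact ⟨s, Or.inr ⟨a, b, hab, Or.inr hs⟩, h⟩

/-- Iterating `exists_refinement`, with prescribed points depending on the step. -/
lemma exists_refinement_sequence [Nonempty K] (F : ℕ → K → K → Set K)
    (hF : ∀ n a b, a < b → (F n a b).Finite ∧ F n a b ⊆ Icc a b) :
    ∃ L : ℕ → Set K, (∀ n, IsCompact (L n) ∧ IsScattered (L n)) ∧
      (∀ n x, ∃ l ∈ L n, l ≤ x) ∧ (∀ n x, ∃ l ∈ L n, x ≤ l) ∧ Monotone L ∧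
      ∀ n a b, IsGap (L n) a b → F n a b ⊆ L (n + 1) ∧
        (∀ c, a ≤ c → c < b → ∃ s ∈ L (n + 1), c ≤ s ∧ s < b) ∧
        (∀ c, a < c → c ≤ b → ∃ s ∈ L (n + 1), a < s ∧ s ≤ c) := by
  let P : Set K → Prop := fun L =>
    (IsCompact L ∧ IsScattered L) ∧ (∀ x, ∃ l ∈ L, l ≤ x) ∧ ∀ x, ∃ l ∈ L, x ≤ l
  obtain ⟨p, -, hp⟩ := (isCompact_univ (X := K)).exists_isLeast univ_nonempty
  obtain ⟨q, -, hq⟩ := (isCompact_univ (X := K)).exists_isGreatest univ_nonempty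
  have hP0 : P {p, q} := ⟨⟨(toFinite _).isCompact, (toFinite _).isScattered⟩,
    fun x => ⟨p, by simp, hp trivial⟩, fun x => ⟨q, by simp, hq trivial⟩⟩
  have hstep : ∀ (n : ℕ) (L : {L // P L}), ∃ L' : {L // P L}, L.1 ⊆ L'.1 ∧
      ∀ a b, IsGap L.1 a b → F n a b ⊆ L'.1 ∧
        (∀ c, a ≤ c → c < b → ∃ s ∈ L'.1, c ≤ s ∧ s < b) ∧
        (∀ c, a < c → c ≤ b → ∃ s ∈ L'.1, a < s ∧ s ≤ c) := by
    rintro n ⟨L, ⟨hL, hs⟩, hbot, htop⟩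
    obtain ⟨L', hsub, hc, hs', h⟩ := exists_refinement hL hs hbot htop (F n) (hF n)
    exact ⟨⟨L', ⟨hc, hs'⟩, fun x => (hbot x).imp fun l hl => ⟨hsub hl.1, hl.2⟩,
      fun x => (htop x).imp fun l hl => ⟨hsub hl.1, hl.2⟩⟩, hsub, h⟩
  choose next hsub hnext using hstep
  let L : ℕ → {L // P L} := fun n => Nat.rec ⟨{p, q}, hP0⟩ next n
  exact ⟨fun n => (L n).1, fun n => (L n).2.1, fun n => (L n).2.2.1, fun n => (L n).2.2.2,
    monotone_nat_of_le_succ fun n => hsub n (L n), fun n => hnext n (L n)⟩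

end Refinement

/-! ### Upper semicontinuous functions on shrinking intervals -/

section Shrinking

variable {K : Type*} [LinearOrder K] [TopologicalSpace K] [OrderTopology K]
  {O : Type*} [LinearOrder O]

/-- On a compact interval, the set where an upper semicontinuous function attains its maximum has
a least element `s` and a greatest element `t`. -/
lemma exists_first_last_argmax [CompactSpace K] {r : K → O} (hr : UpperSemicontinuous r) {a b : K}
    (hab : a ≤ b) :
    ∃ s ∈ Icc a b, ∃ t ∈ Icc a b, r t = r s ∧ ∀ z ∈ Icc a b, r z ≤ r s ∧
      (r z = r s → s ≤ z ∧ z ≤ t) := by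
  obtain ⟨m, hm, hmax⟩ := UpperSemicontinuousOn.exists_isMaxOn (nonempty_Icc.2 hab)
    isClosed_Icc.isCompact (hr.upperSemicontinuousOn (Icc a b))
  have hcl : IsCompact (Icc a b ∩ (r ⁻¹' Iio (r m))ᶜ) :=
    (isClosed_Icc.inter
      ((upperSemicontinuous_iff_isOpen_preimage.1 hr (r m)).isClosed_compl)).isCompact
  have hmem : ∀ z ∈ Icc a b, r z = r m → z ∈ Icc a b ∩ (r ⁻¹' Iio (r m))ᶜ :=
    fun z hz hzm => ⟨hz, fun h => (hzm.not_lt h).elim⟩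
  have heq : ∀ z ∈ Icc a b ∩ (r ⁻¹' Iio (r m))ᶜ, r z = r m :=
    fun z hz => le_antisymm (hmax hz.1) (not_lt.1 hz.2)
  obtain ⟨s, hs, hs'⟩ := hcl.exists_isLeast ⟨m, hmem m hm rfl⟩
  obtain ⟨t, ht, ht'⟩ := hcl.exists_isGreatest ⟨m, hmem m hm rfl⟩
  refine ⟨s, hs.1, t, ht.1, (heq t ht).trans (heq s hs).symm, fun z hz => ?_⟩
  rw [heq s hs]
  exact ⟨hmax hz, fun h => ⟨hs' (hmem z hz h), ht' (hmem z hz h)⟩⟩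

/-- If `r` has the same maximum `ρ` on all intervals of a strictly shrinking sequence and its first
maximum point in one interval never lies inside the next one, then the least point `x` of the
intersection has `r x = ρ`: otherwise `r < ρ` on a neighbourhood of `x`, hence on the intervals
left over once `x` and the first maximum points have been separated. -/
lemma eq_of_isLeast_iInter {r : K → O} (hr : UpperSemicontinuous r) {a b : ℕ → K}
    (ha : StrictMono a) (hb : StrictAnti b) {ρ : O} {N : ℕ}
    (h : ∀ n, N ≤ n → ∃ s ∈ Icc (a n) (b n), r s = ρ ∧
      (∀ z ∈ Icc (a n) (b n), r z ≤ ρ ∧ (r z = ρ → s ≤ z)) ∧ s ∉ Ioo (a (n + 1)) (b (n + 1)))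
    {x : K} (hx : IsLeast (⋂ n, Icc (a n) (b n)) x) : r x = ρ := by
  have hxm : ∀ n, x ∈ Icc (a n) (b n) := mem_iInter.1 hx.1
  have hle : r x ≤ ρ := by
    obtain ⟨s, -, -, hmax, -⟩ := h N le_rfl
    exact (hmax x (hxm N)).1
  by_contra hne
  have hnhds : r ⁻¹' Iio ρ ∈ 𝓝 x :=
    (upperSemicontinuous_iff_isOpen_preimage.1 hr ρ).mem_nhds (lt_of_le_of_ne hle hne)
  obtain ⟨c, hcx, hc⟩ := exists_Ioc_subset_of_mem_nhds hnhds
    ⟨a 0, (ha Nat.zero_lt_one).trans_le (hxm 1).1⟩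
  obtain ⟨k, hk⟩ : ∃ k, c < a k := by
    have : c ∉ ⋂ n, Icc (a n) (b n) := fun hmem => hcx.not_ge (hx.2 hmem)
    simp only [mem_iInter, not_forall] at this
    obtain ⟨k, hk⟩ := this
    exact ⟨k, not_le.1 fun hle => hk ⟨hle, hcx.le.trans (hxm k).2⟩⟩
  set n := max N k
  have hcn : c < a n := hk.trans_le (ha.monotone (le_max_right _ _))
  obtain ⟨s, hs, hsρ, hmin, hsn⟩ := h n (le_max_left _ _)
  obtain ⟨s', hs', hsρ', -, -⟩ := h (n + 2) ((le_max_left _ _).trans (Nat.le_add_right _ _))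
  have hxs : x < s := by
    by_contra! hsx
    exact absurd hsρ (ne_of_lt (hc ⟨hcn.trans_le hs.1, hsx⟩))
  have hbs : b (n + 1) ≤ s := by
    by_contra! hlt
    exact hsn ⟨(hxm (n + 1)).1.trans_lt hxs, hlt⟩
  have hss' : s ≤ s' := (hmin s' ⟨(ha.monotone (Nat.le_add_right _ _)).trans hs'.1,
    hs'.2.trans (hb.antitone (Nat.le_add_right _ _))⟩).2 hsρ'
  exact (hb (Nat.lt_succ_self (n + 1))).not_ge (hbs.trans (hss'.trans hs'.2))

lemma eq_of_isGreatest_iInter {r : K → O} (hr : UpperSemicontinuous r) {a b : ℕ → K}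
    (ha : StrictMono a) (hb : StrictAnti b) {ρ : O} {N : ℕ}
    (h : ∀ n, N ≤ n → ∃ t ∈ Icc (a n) (b n), r t = ρ ∧
      (∀ z ∈ Icc (a n) (b n), r z ≤ ρ ∧ (r z = ρ → z ≤ t)) ∧ t ∉ Ioo (a (n + 1)) (b (n + 1)))
    {x : K} (hx : IsGreatest (⋂ n, Icc (a n) (b n)) x) : r x = ρ := by
  have hr' : UpperSemicontinuous (r ∘ OrderDual.ofDual : Kᵒᵈ → O) := hr
  have ha' : StrictAnti (OrderDual.toDual ∘ a) := fun i j hij => ha hij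
  have hb' : StrictMono (OrderDual.toDual ∘ b) := fun i j hij => hb hij
  have hmem : ∀ z, z ∈ ⋂ n, Icc (a n) (b n) ↔
      OrderDual.toDual z ∈ ⋂ n, Icc ((OrderDual.toDual ∘ b) n) ((OrderDual.toDual ∘ a) n) := by
    intro z
    simp only [mem_iInter]
    exact forall_congr' fun n => ⟨fun h => ⟨h.2, h.1⟩, fun h => ⟨h.2, h.1⟩⟩
  have hx' : IsLeast (⋂ n, Icc ((OrderDual.toDual ∘ b) n) ((OrderDual.toDual ∘ a) n))
      (OrderDual.toDual x) :=
    ⟨(hmem x).1 hx.1, fun y hy => hx.2 ((hmem (OrderDual.ofDual y)).2 hy)⟩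
  refine eq_of_isLeast_iInter hr' hb' ha' (ρ := ρ) (N := N) (fun n hn => ?_) hx'
  obtain ⟨t, ht, h1, h2, h3⟩ := h n hn
  exact ⟨OrderDual.toDual t, ⟨ht.2, ht.1⟩, h1, fun z hz => h2 (OrderDual.ofDual z) ⟨hz.2, hz.1⟩,
    fun h' => h3 ⟨h'.2, h'.1⟩⟩

/-- Let countably many upper semicontinuous functions with well-ordered values separate the points
of `K`, and let the intervals `[a n, b n]` shrink strictly. If the first and last maximum points
of the `m`-th function on the `n`-th interval avoid the interior of the next interval whenever
`m ≤ n`, then the intersection is a single point. -/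
lemma eq_of_mem_iInter_Icc [CompactSpace K] [WellFoundedLT O] {r : ℕ → K → O}
    (hr : ∀ m, UpperSemicontinuous (r m)) (hsep : ∀ x y, (∀ m, r m x = r m y) → x = y)
    {s t : ℕ → K → K → K}
    (hst : ∀ m a b, a ≤ b → s m a b ∈ Icc a b ∧ t m a b ∈ Icc a b ∧
      r m (t m a b) = r m (s m a b) ∧ ∀ z ∈ Icc a b, r m z ≤ r m (s m a b) ∧
        (r m z = r m (s m a b) → s m a b ≤ z ∧ z ≤ t m a b))
    {a b : ℕ → K} (ha : StrictMono a) (hb : StrictAnti b)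
    (hs : ∀ m n, m ≤ n → s m (a n) (b n) ∉ Ioo (a (n + 1)) (b (n + 1)))
    (ht : ∀ m n, m ≤ n → t m (a n) (b n) ∉ Ioo (a (n + 1)) (b (n + 1)))
    {u v : K} (hu : ∀ n, u ∈ Icc (a n) (b n)) (hv : ∀ n, v ∈ Icc (a n) (b n)) : u = v := by
  have hab : ∀ n, a n ≤ b n := fun n => (hu n).1.trans (hu n).2
  have hcompact : IsCompact (⋂ n, Icc (a n) (b n)) :=
    (isClosed_iInter fun n => isClosed_Icc).isCompact
  obtain ⟨x, hx⟩ := hcompact.exists_isLeast ⟨u, mem_iInter.2 hu⟩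
  obtain ⟨y, hy⟩ := hcompact.exists_isGreatest ⟨u, mem_iInter.2 hu⟩
  suffices hxy : x = y by
    have h : ∀ z ∈ ⋂ n, Icc (a n) (b n), z = x := fun z hz =>
      le_antisymm (hxy ▸ hy.2 hz) (hx.2 hz)
    rw [h u (mem_iInter.2 hu), h v (mem_iInter.2 hv)]
  refine hsep x y fun m => ?_
  -- The maxima of `r m` on the intervals decrease, so they are constant from some `N` on.
  have hanti : Antitone fun n => r m (s m (a n) (b n)) := by
    intro i j hij
    have hmem := (hst m (a j) (b j) (hab j)).1
    exact ((hst m (a i) (b i) (hab i)).2.2.2 _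
      ⟨(ha.monotone hij).trans hmem.1, hmem.2.trans (hb.antitone hij)⟩).1
  obtain ⟨N, hN⟩ := WellFoundedGT.monotone_chain_condition
    (α := Oᵒᵈ) ⟨fun n => OrderDual.toDual (r m (s m (a n) (b n))), hanti⟩
  have hN' : ∀ n, max N m ≤ n → r m (s m (a n) (b n)) = r m (s m (a N) (b N)) :=
    fun n hn => (OrderDual.toDual.injective (hN n ((le_max_left _ _).trans hn))).symm
  have hxρ : r m x = r m (s m (a N) (b N)) := by
    refine eq_of_isLeast_iInter (hr m) ha hb (N := max N m) (fun n hn => ?_) hx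
    obtain ⟨h1, -, -, h4⟩ := hst m (a n) (b n) (hab n)
    rw [← hN' n hn]
    exact ⟨s m (a n) (b n), h1, rfl, fun z hz => ⟨(h4 z hz).1, fun h => ((h4 z hz).2 h).1⟩,
      hs m n ((le_max_right _ _).trans hn)⟩
  have hyρ : r m y = r m (s m (a N) (b N)) := by
    refine eq_of_isGreatest_iInter (hr m) ha hb (N := max N m) (fun n hn => ?_) hy
    obtain ⟨-, h2, h3, h4⟩ := hst m (a n) (b n) (hab n)
    rw [← hN' n hn]
    exact ⟨t m (a n) (b n), h2, h3, fun z hz => ⟨(h4 z hz).1, fun h => ((h4 z hz).2 h).2⟩,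
      ht m n ((le_max_right _ _).trans hn)⟩
  exact hxρ.trans hyρ.symm

end Shrinking

/-! ### From a fragmenting metric to scattered sets -/

section Scatter

variable {K : Type*} [LinearOrder K] [TopologicalSpace K] [OrderTopology K] [CompactSpace K]

universe u

lemma IsFragmentable.exists_rank_sequence {X : Type u} [TopologicalSpace X]
    (h : IsFragmentable X) :
    ∃ r : ℕ → X → Ordinal.{u}, (∀ m, UpperSemicontinuous (r m)) ∧
      ∀ x y, (∀ m, r m x = r m y) → x = y := by
  obtain ⟨d, hd, hfrag⟩ := h
  choose r hr hsmall using fun m : ℕ =>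
    hfrag.exists_rank (ε := 1 / ((m : ℝ) + 1)) Nat.one_div_pos_of_nat
  refine ⟨r, hr, fun x y hxy => (hd.eq_zero_iff x y).1 ?_⟩
  by_contra hne
  obtain ⟨m, hm⟩ := exists_nat_one_div_lt (lt_of_le_of_ne (hd.nonneg x y) (Ne.symm hne))
  exact hm.asymm (hsmall m x y (hxy m))

lemma exists_scattered_of_isFragmentable (h : IsFragmentable K) :
    ∃ L : ℕ → Set K, (∀ n, IsCompact (L n) ∧ IsScattered (L n)) ∧
      ∀ u v : K, u < v → ∃ x ∈ ⋃ n, L n, ∃ y ∈ ⋃ n, L n, u ≤ x ∧ x < y ∧ y ≤ v := by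
  rcases isEmpty_or_nonempty K with hK | hK
  · exact ⟨fun _ => ∅, fun _ => ⟨isCompact_empty, finite_empty.isScattered⟩, fun u => hK.elim u⟩
  obtain ⟨r, hr, hsep⟩ := h.exists_rank_sequence
  have hex : ∀ m a b, ∃ s t, a ≤ b → s ∈ Icc a b ∧ t ∈ Icc a b ∧
      r m t = r m s ∧ ∀ z ∈ Icc a b, r m z ≤ r m s ∧ (r m z = r m s → s ≤ z ∧ z ≤ t) := by
    intro m a b
    by_cases hab : a ≤ b
    · obtain ⟨s, hs, t, ht, h⟩ := exists_first_last_argmax (hr m) hab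
      exact ⟨s, t, fun _ => ⟨hs, ht, h⟩⟩
    · exact ⟨a, a, fun h => absurd h hab⟩
  choose s t hst using hex
  obtain ⟨L, hL, hbot, htop, hmono, hgap⟩ := exists_refinement_sequence
    (fun n a b => ⋃ m ∈ Iic n, {s m a b, t m a b}) fun n a b hab => by
      refine ⟨(finite_Iic n).biUnion fun m _ => toFinite _, iUnion₂_subset fun m _ => ?_⟩
      rintro x (rfl | rfl)
      · exact (hst m a b hab.le).1
      · exact (hst m a b hab.le).2.1
  refine ⟨L, hL, fun u v huv => ?_⟩
  -- Next to a point of `L`, every nonempty half-open interval contains another point of `L`.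
  have hleft : ∀ u' v', u' < v' → v' ∈ ⋃ n, L n → ∃ x ∈ ⋃ n, L n, u' ≤ x ∧ x < v' := by
    intro u' v' hlt hv'
    obtain ⟨n, hn⟩ := mem_iUnion.1 hv'
    by_cases hempty : ∀ x ∈ L n, x ≤ u' ∨ v' ≤ x
    · obtain ⟨a, b, hab, hau, hvb⟩ := exists_isGap (hL n).1 hlt.le (hbot n u') (htop n v') hempty
        (Or.inl hlt)
      obtain rfl : b = v' :=
        le_antisymm ((hab.2.2.2 v' hn).resolve_left ((hau.trans_lt hlt).not_ge)) hvb
      obtain ⟨x, hx, hux, hxv⟩ := (hgap n a b hab).2.1 u' hau hlt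
      exact ⟨x, mem_iUnion.2 ⟨_, hx⟩, hux, hxv⟩
    · push Not at hempty
      obtain ⟨x, hx, hux, hxv⟩ := hempty
      exact ⟨x, mem_iUnion.2 ⟨n, hx⟩, hux.le, hxv⟩
  have hright : ∀ u' v', u' < v' → u' ∈ ⋃ n, L n → ∃ x ∈ ⋃ n, L n, u' < x ∧ x ≤ v' := by
    intro u' v' hlt hu'
    obtain ⟨n, hn⟩ := mem_iUnion.1 hu'
    by_cases hempty : ∀ x ∈ L n, x ≤ u' ∨ v' ≤ x
    · obtain ⟨a, b, hab, hau, hvb⟩ := exists_isGap (hL n).1 hlt.le (hbot n u') (htop n v') hempty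
        (Or.inl hlt)
      obtain rfl : a = u' :=
        le_antisymm hau ((hab.2.2.2 u' hn).resolve_right ((hlt.trans_le hvb).not_ge))
      obtain ⟨x, hx, hux, hxv⟩ := (hgap n a b hab).2.2 v' hlt hvb
      exact ⟨x, mem_iUnion.2 ⟨_, hx⟩, hux, hxv⟩
    · push Not at hempty
      obtain ⟨x, hx, hux, hxv⟩ := hempty
      exact ⟨x, mem_iUnion.2 ⟨n, hx⟩, hux, hxv.le⟩
  suffices hmeet : ∃ p ∈ ⋃ n, L n, u ≤ p ∧ p ≤ v by
    obtain ⟨p, hp, hup, hpv⟩ := hmeet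
    rcases hup.lt_or_eq with hlt | rfl
    · obtain ⟨x, hx, hux, hxp⟩ := hleft u p hlt hp
      exact ⟨x, hx, p, hp, hux, hxp, hpv⟩
    · obtain ⟨y, hy, huy, hyv⟩ := hright u v huv hp
      exact ⟨u, hp, y, hy, le_rfl, huy, hyv⟩
  by_contra! hmiss
  have hmiss' : ∀ n, ∀ x ∈ L n, x < u ∨ v < x := fun n x hx => by
    by_contra! h
    exact (hmiss x (mem_iUnion.2 ⟨n, hx⟩) h.1).not_ge h.2
  choose a b hab hau hvb using fun n => exists_isGap (hL n).1 huv.le (hbot n u) (htop n v)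
    (fun x hx => (hmiss' n x hx).imp le_of_lt le_of_lt) (Or.inl huv)
  have hau' : ∀ n, a n < u := fun n =>
    (hmiss' n _ (hab n).1).resolve_right ((hau n).trans_lt huv).asymm
  have hvb' : ∀ n, v < b n := fun n =>
    (hmiss' n _ (hab n).2.1).resolve_left (huv.trans_le (hvb n)).asymm
  have ha : StrictMono a := strictMono_nat_of_lt_succ fun n => by
    obtain ⟨x, hx, hax, hxu⟩ := (hgap n _ _ (hab n)).2.2 u (hau' n) (huv.le.trans (hvb n))
    exact hax.trans_le (((hab (n + 1)).2.2.2 x hx).resolve_right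
      ((hxu.trans_lt huv).trans (hvb' (n + 1))).not_ge)
  have hb : StrictAnti b := strictAnti_nat_of_succ_lt fun n => by
    obtain ⟨x, hx, hvx, hxb⟩ := (hgap n _ _ (hab n)).2.1 v ((hau n).trans huv.le) (hvb' n)
    exact (((hab (n + 1)).2.2.2 x hx).resolve_left
      (((hau' (n + 1)).trans huv).trans_le hvx).not_ge).trans_lt hxb
  refine huv.ne (eq_of_mem_iInter_Icc hr hsep hst ha hb (fun m n hmn => ?_) (fun m n hmn => ?_)
    (fun n => ⟨hau n, huv.le.trans (hvb n)⟩) fun n => ⟨(hau n).trans huv.le, hvb n⟩)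
  · exact (hab (n + 1)).notMem_Ioo ((hgap n _ _ (hab n)).1 (mem_biUnion hmn (Or.inl rfl)))
  · exact (hab (n + 1)).notMem_Ioo ((hgap n _ _ (hab n)).1 (mem_biUnion hmn (Or.inr rfl)))

end Scatter

/-! ### From scattered sets to a lower semicontinuous fragmenting metric -/

section Metric

variable {K : Type*} [LinearOrder K] [TopologicalSpace K] [OrderTopology K]

/-- If to every gap of a closed scattered set `L` belongs a continuous function that is constant on
both sides of the gap, then these functions vary little, uniformly in the gap, on a relatively open
part of any given set `M`: near a point outside `L` at most one of them varies. -/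
lemma IsScattered.exists_isOpen_gap_oscillation {L : Set K} (hs : IsScattered L)
    (hL : IsClosed L) {f : K → K → K → ℝ} (hf : ∀ a b, Continuous (f a b))
    (hf0 : ∀ a b, IsGap L a b → ∀ x ≤ a, f a b x = 0)
    (hf1 : ∀ a b, IsGap L a b → ∀ x, b ≤ x → f a b x = 1)
    {M : Set K} (hM : M.Nonempty) {δ : ℝ} (hδ : 0 < δ) :
    ∃ U, IsOpen U ∧ (M ∩ U).Nonempty ∧
      ∀ x ∈ M ∩ U, ∀ y ∈ M ∩ U, ∀ a b, IsGap L a b → |f a b x - f a b y| ≤ δ := by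
  by_cases hML : M ⊆ L
  · obtain ⟨p, -, U, hU, hMU⟩ := hs M hML hM
    refine ⟨U, hU, hMU ▸ singleton_nonempty p, fun x hx y hy a b _ => ?_⟩
    rw [hMU] at hx hy
    rw [hx, hy, sub_self, abs_zero]
    exact hδ.le
  obtain ⟨p, hpM, hpL⟩ := not_subset.1 hML
  have hnhds : ordConnectedComponent Lᶜ p ∈ 𝓝 p :=
    ordConnectedComponent_mem_nhds.2 (hL.isOpen_compl.mem_nhds hpL)
  have hconst : ∀ x ∈ ordConnectedComponent Lᶜ p, ∀ a b, IsGap L a b → p ∉ Ioo a b →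
      f a b x = f a b p := by
    intro x hx a b hab hp
    have hmiss : ∀ l ∈ L, l ∉ uIcc p x := fun l hl hlx => hx hlx hl
    rcases not_and_or.1 hp with hpa | hpb
    · have hxa : x ≤ a := by
        by_contra! hax
        exact hmiss a hab.1 (mem_uIcc.2 (Or.inl ⟨not_lt.1 hpa, hax.le⟩))
      rw [hf0 a b hab x hxa, hf0 a b hab p (not_lt.1 hpa)]
    · have hbx : b ≤ x := by
        by_contra! hxb
        exact hmiss b hab.2.1 (mem_uIcc.2 (Or.inr ⟨hxb.le, not_lt.1 hpb⟩))
      rw [hf1 a b hab x hbx, hf1 a b hab p (not_lt.1 hpb)]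
  by_cases hgap : ∃ a b, IsGap L a b ∧ p ∈ Ioo a b
  · obtain ⟨a, b, hab, hp⟩ := hgap
    have hcont : ∀ᶠ x in 𝓝 p, |f a b x - f a b p| < δ / 2 :=
      Metric.continuousAt_iff'.1 (hf a b).continuousAt (δ / 2) (half_pos hδ)
    obtain ⟨U, hU, hUo, hpU⟩ := mem_nhds_iff.1 (inter_mem hnhds hcont)
    refine ⟨U, hUo, ⟨p, hpM, hpU⟩, fun x hx y hy a' b' hab' => ?_⟩
    by_cases hp' : p ∈ Ioo a' b'
    · obtain ⟨rfl, rfl⟩ := hab.eq_of_mem_Ioo hab' hp hp'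
      have h1 : |f a b x - f a b p| < δ / 2 := (hU hx.2).2
      have h2 : |f a b y - f a b p| < δ / 2 := (hU hy.2).2
      rw [abs_lt] at h1 h2
      rw [abs_le]
      constructor <;> linarith
    · rw [hconst x (hU hx.2).1 a' b' hab' hp', hconst y (hU hy.2).1 a' b' hab' hp', sub_self,
        abs_zero]
      exact hδ.le
  · push Not at hgap
    obtain ⟨U, hU, hUo, hpU⟩ := mem_nhds_iff.1 hnhds
    refine ⟨U, hUo, ⟨p, hpM, hpU⟩, fun x hx y hy a b hab => ?_⟩
    rw [hconst x (hU hx.2) a b hab (hgap a b hab), hconst y (hU hy.2) a b hab (hgap a b hab),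
      sub_self, abs_zero]
    exact hδ.le

/-- Finitely many conditions, each of which can be met on a relatively open part of every
nonempty set and is inherited by subsets, can be met simultaneously. -/
lemma exists_isOpen_forall_lt {X : Type*} [TopologicalSpace X] {P : ℕ → Set X → Prop}
    (hmono : ∀ n A B, A ⊆ B → P n B → P n A)
    (hP : ∀ n (M : Set X), M.Nonempty → ∃ U, IsOpen U ∧ (M ∩ U).Nonempty ∧ P n (M ∩ U))
    {M : Set X} (hM : M.Nonempty) (N : ℕ) :
    ∃ U, IsOpen U ∧ (M ∩ U).Nonempty ∧ ∀ n < N, P n (M ∩ U) := by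
  induction N with
  | zero => exact ⟨univ, isOpen_univ, by simpa using hM, by simp⟩
  | succ N ih =>
    obtain ⟨U, hU, hne, hlt⟩ := ih
    obtain ⟨V, hV, hne', hN⟩ := hP N (M ∩ U) hne
    rw [inter_assoc] at hne' hN
    refine ⟨U ∩ V, hU.inter hV, hne', fun n hn => ?_⟩
    rcases Nat.lt_succ_iff_lt_or_eq.1 hn with h | rfl
    · exact hmono n _ _ (inter_subset_inter_right M inter_subset_left) (hlt n h)
    · exact hN

lemma isRadonNikodym_of_exists_scattered
    (h : ∃ L : ℕ → Set K, (∀ n, IsCompact (L n) ∧ IsScattered (L n)) ∧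
      ∀ u v : K, u < v → ∃ x ∈ ⋃ n, L n, ∃ y ∈ ⋃ n, L n, u ≤ x ∧ x < y ∧ y ≤ v) :
    IsRadonNikodym K := by
  obtain ⟨L₀, hL₀, hsep⟩ := h
  -- Any two of the given sets lie together in some `L n`.
  let L : ℕ → Set K := fun n => L₀ n.unpair.1 ∪ L₀ n.unpair.2
  have hLc : ∀ n, IsCompact (L n) := fun n => (hL₀ _).1.union (hL₀ _).1
  have hLs : ∀ n, IsScattered (L n) := fun n => (hL₀ _).2.union (hL₀ _).2 (hL₀ _).1.isClosed
  have hgap : ∀ u v : K, u < v → ∃ n a b, IsGap (L n) a b ∧ u ≤ a ∧ b ≤ v := by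
    intro u v huv
    obtain ⟨x, hx, y, hy, hux, hxy, hyv⟩ := hsep u v huv
    obtain ⟨i, hi⟩ := mem_iUnion.1 hx
    obtain ⟨j, hj⟩ := mem_iUnion.1 hy
    have hxL : x ∈ L (Nat.pair i j) := by simp [L, hi]
    have hyL : y ∈ L (Nat.pair i j) := by simp [L, hj]
    obtain ⟨a, b, hab, hxa, hby⟩ := (hLs _).exists_isGap_between (hLc _) hxL hyL hxy
    exact ⟨_, a, b, hab, hux.trans hxa, hby.trans hyv⟩
  have hury : ∀ a b : K, ∃ f : K → ℝ, Continuous f ∧ (∀ x, f x ∈ Icc (0 : ℝ) 1) ∧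
      (a < b → (∀ x ≤ a, f x = 0) ∧ ∀ x, b ≤ x → f x = 1) := by
    intro a b
    by_cases hab : a < b
    · obtain ⟨f, hf0, hf1, hf⟩ := exists_continuous_zero_one_of_isClosed
        (isClosed_Iic (a := a)) (isClosed_Ici (a := b))
        (disjoint_left.2 fun x hx hx' => (hx.trans_lt hab).not_ge hx')
      exact ⟨f, f.continuous, hf, fun _ => ⟨fun x hx => hf0 hx, fun x hx => hf1 hx⟩⟩
    · exact ⟨fun _ => 0, continuous_const, fun _ => by simp, fun h => absurd h hab⟩
  choose f hfc hf01 hfab using hury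
  let ι := {i : ℕ × K × K // IsGap (L i.1) i.2.1 i.2.2}
  let g : ι → K × K → ℝ := fun i p =>
    (1 / 2 : ℝ) ^ i.1.1 * |f i.1.2.1 i.1.2.2 p.1 - f i.1.2.1 i.1.2.2 p.2|
  have habs : ∀ a b x y, |f a b x - f a b y| ≤ 1 := by
    intro a b x y
    have hx := hf01 a b x
    have hy := hf01 a b y
    rw [abs_le]
    constructor <;> linarith [hx.1, hx.2, hy.1, hy.2]
  have hg0 : ∀ i p, 0 ≤ g i p := fun i p => by positivity
  have hgpow : ∀ i p, g i p ≤ (1 / 2 : ℝ) ^ i.1.1 := fun i p =>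
    mul_le_of_le_one_right (by positivity) (habs _ _ _ _)
  have hgabs : ∀ i p, g i p ≤ |f i.1.2.1 i.1.2.2 p.1 - f i.1.2.1 i.1.2.2 p.2| := fun i p =>
    mul_le_of_le_one_left (abs_nonneg _) (pow_le_one₀ (by norm_num) (by norm_num))
  have hbdd : ∀ p, BddAbove (range fun i => g i p) := fun p =>
    ⟨1, forall_mem_range.2 fun i => (hgpow i p).trans (pow_le_one₀ (by norm_num) (by norm_num))⟩
  let d : K → K → ℝ := fun x y => ⨆ i, g i (x, y)
  have hd0 : ∀ x y, 0 ≤ d x y := fun x y => Real.iSup_nonneg fun i => hg0 i _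
  have hsymm : ∀ x y, d x y = d y x := fun x y =>
    iSup_congr fun i => by simp only [g]; rw [abs_sub_comm]
  have hpos : ∀ x y, x < y → 0 < d x y := by
    intro x y hxy
    obtain ⟨n, a, b, hab, hxa, hby⟩ := hgap x y hxy
    refine lt_of_lt_of_le ?_ (le_ciSup (hbdd (x, y)) ⟨(n, a, b), hab⟩)
    simp only [g]
    rw [(hfab a b hab.2.2.1).1 x hxa, (hfab a b hab.2.2.1).2 y hby]
    norm_num
  refine ⟨d, ⟨hd0, fun x y => ⟨fun h => ?_, ?_⟩, hsymm, fun x y z => ?_⟩, fun M hM ε hε => ?_, ?_⟩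
  · rcases lt_trichotomy x y with hlt | heq | hlt
    · exact absurd h (hpos x y hlt).ne'
    · exact heq
    · exact absurd ((hsymm y x).trans h) (hpos y x hlt).ne'
  · rintro rfl
    simp [d, g]
  · refine Real.iSup_le (fun i => ?_) (add_nonneg (hd0 x y) (hd0 y z))
    calc g i (x, z) ≤ g i (x, y) + g i (y, z) := by
          simp only [g]
          rw [← mul_add]
          exact mul_le_mul_of_nonneg_left (abs_sub_le _ _ _) (by positivity)
      _ ≤ d x y + d y z := add_le_add (le_ciSup (hbdd _) i) (le_ciSup (hbdd _) i)
  · obtain ⟨N, hN⟩ := exists_pow_lt_of_lt_one (half_pos hε) (by norm_num : (1 / 2 : ℝ) < 1)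
    -- The gaps of `L n` for `n ≥ N` contribute at most `ε / 2` anyway.
    obtain ⟨U, hU, hne, hsmall⟩ := exists_isOpen_forall_lt
      (P := fun n A => ∀ x ∈ A, ∀ y ∈ A, ∀ a b, IsGap (L n) a b → |f a b x - f a b y| ≤ ε / 2)
      (fun n A B hAB hB x hx y hy => hB x (hAB hx) y (hAB hy))
      (fun n M hM => (hLs n).exists_isOpen_gap_oscillation (hLc n).isClosed hfc
        (fun a b hab => (hfab a b hab.2.2.1).1) (fun a b hab => (hfab a b hab.2.2.1).2) hM
        (half_pos hε)) hM N
    refine ⟨U, hU, hne, lt_of_le_of_lt (iSup₂_le fun x hx => iSup₂_le fun y hy =>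
      ENNReal.ofReal_le_ofReal (Real.iSup_le (fun i => ?_) (half_pos hε).le))
      ((ENNReal.ofReal_lt_ofReal_iff hε).2 (half_lt_self hε))⟩
    rcases lt_or_ge i.1.1 N with hi | hi
    · exact (hgabs i _).trans (hsmall _ hi x hx y hy _ _ i.2)
    · exact (hgpow i _).trans
        ((pow_le_pow_of_le_one (by norm_num) (by norm_num) hi).trans hN.le)
  · refine lowerSemicontinuous_ciSup hbdd fun i => Continuous.lowerSemicontinuous ?_
    have hi := hfc i.1.2.1 i.1.2.2
    simp only [g]
    fun_prop

end Metric

end FragOrder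

theorem theorem1p2 (K : Type*) [LinearOrder K] [TopologicalSpace K] [OrderTopology K]
    [CompactSpace K] :
    List.TFAE [
      FragOrder.IsFragmentable K,
      ∃ L : ℕ → Set K, (∀ n, IsCompact (L n) ∧ FragOrder.IsScattered (L n)) ∧
        ∀ u v : K, u < v → ∃ x ∈ ⋃ n, L n, ∃ y ∈ ⋃ n, L n, u ≤ x ∧ x < y ∧ y ≤ v,
      FragOrder.IsRadonNikodym K] := by
  tfae_have 1 → 2 := FragOrder.exists_scattered_of_isFragmentable
  tfae_have 2 → 3 := FragOrder.isRadonNikodym_of_exists_scattered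
  tfae_have 3 → 1 := fun ⟨d, hd, hfrag, _⟩ => ⟨d, hd, hfrag⟩
  tfae_finish
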